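/- For a finite graph $G$, let $\mathrm{UM}(G)$ be the unique-maximum chromatic number of $G$ with respect to paths, that is, the least $k$ for which there is a vertex coloring $C\colon V(G)\to\{1,\dots,k\}$ such that on the vertices of every path of $G$ the maximum color occurs exactly once. The graph $G$ is called $k$-UM-critical if $\mathrm{UM}(G)=k$ and every proper subgraph $H$ of $G$ satisfies $\mathrm{UM}(H)<k$. Let $B_d$ be the complete (rooted) binary tree with $d$ levels, which has $2^d-1$ vertices. A subdivision of a graph $B$ is a graph obtained from $B$ by replacing every edge of $B$ by a path (with at least one edge), where the paths of distinct edges share no inner vertices. Let $k\ge 3$ and $l\ge 0$ be integers, and let $T$ be a finite $k$-UM-critical tree. Then $T$ contains, as a subgraph, a path with $2^l$ vertices or a subdivision of $B_{\left\lceil \frac{k+l+3}{l+2}\right\rceil}$. -/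

import Mathlib

/-- A colouring `C` of the vertices with colours `0, …, k - 1` is a unique-maximum colouring of the
hypergraph with hyperedge set `E` if in every hyperedge the maximum colour occurs exactly once. -/
def IsUMColoring {V : Type*} (E : Set (Set V)) {k : ℕ} (C : V → Fin k) : Prop :=
  ∀ e ∈ E, ∃ v ∈ e, ∀ w ∈ e, w ≠ v → C w < C v

/-- The hyperedges of the path hypergraph of `G`: all vertex sets spanned by a path of `G`. -/
def pathHyperedges {V : Type*} (G : SimpleGraph V) : Set (Set V) :=
  {e | ∃ (u v : V) (p : G.Walk u v), p.IsPath ∧ e = {x | x ∈ p.support}}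

/-- The unique-maximum chromatic number of `G` with respect to paths: the least number of colours in
a unique-maximum colouring of its path hypergraph. The set of admissible `k` is nonempty for every
finite graph (colour injectively). -/
noncomputable def UM {V : Type*} (G : SimpleGraph V) : ℕ :=
  sInf {k : ℕ | ∃ C : V → Fin k, IsUMColoring (pathHyperedges G) C}

/-- `G` is UM-critical if every proper subgraph of `G` has smaller UM. -/
def IsUMCritical {V : Type*} (G : SimpleGraph V) : Prop :=
  ∀ H : G.Subgraph, H ≠ ⊤ → UM H.coe < UM G

/-- `G` is `k`-UM-critical if it is UM-critical and its UM equals `k`. -/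
def IsKUMCritical {V : Type*} (k : ℕ) (G : SimpleGraph V) : Prop :=
  IsUMCritical G ∧ UM G = k

/-- The complete binary tree `B_d` with `d` levels and `2 ^ d - 1` vertices. A vertex is the sequence
of left/right choices that leads to it from the root `[]`; the two children of `s` are
`s ++ [false]` and `s ++ [true]`. -/
def completeBinaryTree (d : ℕ) : SimpleGraph {s : List Bool // s.length < d} where
  Adj s t := ∃ b : Bool, t.1 = s.1 ++ [b] ∨ s.1 = t.1 ++ [b]
  symm := ⟨fun _ _ ⟨b, h⟩ => ⟨b, h.symm⟩⟩
  loopless := ⟨fun s ⟨b, h⟩ => by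
    rcases h with h | h <;> simpa using congrArg List.length h⟩

/-- `H` is a subdivision of `B`: `H` arises from `B` by substituting every edge by a path. Here `br`
gives the branch vertices and `P` the path that replaces an edge. The conditions say: the two
orientations of an edge have the same path; every `P h` is a path; it meets the branch vertices only
in its ends; the paths of distinct edges meet only in branch vertices; and `H` has no further
vertices and no further edges. -/
def IsSubdivision {U W : Type*} (H : SimpleGraph U) (B : SimpleGraph W) : Prop :=
  ∃ (br : W → U) (P : ∀ ⦃a b : W⦄, B.Adj a b → H.Walk (br a) (br b)),
    Function.Injective br ∧
    (∀ ⦃a b⦄ (h : B.Adj a b), P h.symm = (P h).reverse) ∧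
    (∀ ⦃a b⦄ (h : B.Adj a b), (P h).IsPath) ∧
    (∀ ⦃a b⦄ (h : B.Adj a b) (c : W), br c ∈ (P h).support → c = a ∨ c = b) ∧
    (∀ ⦃a b c d⦄ (h : B.Adj a b) (h' : B.Adj c d), s(a, b) ≠ s(c, d) →
      ∀ x, x ∈ (P h).support → x ∈ (P h').support → x ∈ Set.range br) ∧
    (∀ x : U, x ∈ Set.range br ∨ ∃ (a b : W) (h : B.Adj a b), x ∈ (P h).support) ∧
    (∀ x y : U, H.Adj x y → ∃ (a b : W) (h : B.Adj a b), s(x, y) ∈ (P h).edges)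

/-- `G` contains a subdivision of `B`: some subgraph of `G` is a subdivision of `B`. -/
def ContainsSubdivision {V W : Type*} (G : SimpleGraph V) (B : SimpleGraph W) : Prop :=
  ∃ H : G.Subgraph, IsSubdivision H.coe B

/-- `G` contains a path with `n` vertices. -/
def ContainsPath {V : Type*} (G : SimpleGraph V) (n : ℕ) : Prop :=
  ∃ (u v : V) (p : G.Walk u v), p.IsPath ∧ p.support.length = n

/-! Write the number of levels as `e + 2`; the ceiling gives `e * (l + 2) ≤ k`. Suppose that `T` has
no path with `2 ^ l` vertices and no subdivision of the tree with `e + 2` levels. Call a branch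
large if it contains a binary tree with `e + 1` levels. Two large branches at one vertex would give
a forbidden subdivision, so each vertex has at most one. Hence some edge `pv` has no large branch at
its ends other than possibly those through `pv` itself (`exists_adj_no_large_branch`).

Root `T` at `p` and give each other vertex except `v` the size of the binary tree below it as its
level, which is less than `e`. Levels do not increase downwards, and a vertex with two children
above vertices of equal level `n` has level at least `n + 1`. So vertices of one level are either
separated by a higher level or lie on a common vertical chain. A chain has fewer than `2 ^ l`
vertices, and the ruler sequence (2-adic valuation of the position) colours it with `l` colours.
Using `l` colours per level and two more for `p` and `v` gives `UM T ≤ l * e + 2`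
(`UM_le_of_branches`). For `e = 1` one colour can be saved (`UM_le_of_no_large_branch`). Both bounds
fall below `k`. -/

open SimpleGraph

/-! ### Rooted trees -/

section Rooted

variable {V : Type*}

/-- A neighbour of `x` that is closer to `r`; the root is its own parent. -/
noncomputable def parent (G : SimpleGraph V) (r x : V) : V :=
  open Classical in
  if h : ∃ y, G.Adj y x ∧ G.dist r x = G.dist r y + 1 then h.choose else x

/-- `a` is an ancestor of `x` (or `x` itself) when `G` is rooted at `r`. -/
def IsAncestor (G : SimpleGraph V) (r a x : V) : Prop := ∃ n, (parent G r)^[n] x = a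

variable {G : SimpleGraph V} {r a b x y z : V}

theorem parent_spec (hG : G.IsTree) (hx : x ≠ r) :
    G.Adj (parent G r x) x ∧ G.dist r x = G.dist r (parent G r x) + 1 := by
  have h : ∃ y, G.Adj y x ∧ G.dist r x = G.dist r y + 1 := by
    obtain ⟨p, hp, hl⟩ := hG.connected.exists_path_of_dist x r
    cases p with
    | nil => exact absurd rfl hx
    | cons hadj q =>
      rename_i w
      refine ⟨w, hadj.symm, ?_⟩
      have h1 := dist_le q
      have h2 := hG.dist_eq_dist_add_one_of_adj r hadj
      rw [Walk.length_cons] at hl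
      rw [dist_comm] at hl h1
      omega
  rw [parent, dif_pos h]
  exact h.choose_spec

theorem parent_root : parent G r r = r := by
  have h : ¬ ∃ y, G.Adj y r ∧ G.dist r r = G.dist r y + 1 := by
    rintro ⟨y, -, h⟩
    simp at h
  rw [parent, dif_neg h]

/-- Two closer neighbours would extend geodesics from `r` to two different paths from `r` to `x`. -/
theorem parent_eq (hG : G.IsTree) (hadj : G.Adj y x) (hd : G.dist r x = G.dist r y + 1) :
    parent G r x = y := by
  have hx : x ≠ r := by
    rintro rfl
    simp at hd
  have key : ∀ w, G.Adj w x → G.dist r x = G.dist r w + 1 →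
      ∃ p : G.Walk r x, p.IsPath ∧ p.penultimate = w := by
    intro w hw hd
    obtain ⟨q, hq⟩ := hG.connected.exists_walk_length_eq_dist r w
    refine ⟨q.concat hw, Walk.isPath_of_length_eq_dist _ ?_, by simp⟩
    rw [Walk.length_concat]
    omega
  obtain ⟨h1, h2⟩ := parent_spec hG hx
  obtain ⟨p, hp, hpw⟩ := key _ h1 h2
  obtain ⟨q, hq, hqw⟩ := key _ hadj hd
  rw [← hpw, ← hqw, (hG.existsUnique_path r x).unique hp hq]

theorem parent_eq_or (hG : G.IsTree) (r : V) (hadj : G.Adj x y) :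
    (parent G r y = x ∧ y ≠ r) ∨ (parent G r x = y ∧ x ≠ r) := by
  rcases hG.dist_eq_dist_add_one_of_adj r hadj with h | h
  · exact Or.inr ⟨parent_eq hG hadj.symm h, by rintro rfl; simp at h⟩
  · exact Or.inl ⟨parent_eq hG hadj h, by rintro rfl; simp at h⟩

/-- The root is a fixed point of `parent`, which matches truncated subtraction once `n` exceeds the
depth. -/
theorem dist_iterate_parent (hG : G.IsTree) (n : ℕ) :
    G.dist r ((parent G r)^[n] x) = G.dist r x - n := by
  induction n with
  | zero => rfl
  | succ n ih =>
    rw [Function.iterate_succ_apply']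
    by_cases h : (parent G r)^[n] x = r
    · rw [h, parent_root]
      rw [h] at ih
      simp at ih ⊢
      omega
    · have := (parent_spec hG h).2
      omega

theorem IsAncestor.refl (x : V) : IsAncestor G r x x := ⟨0, rfl⟩

theorem IsAncestor.trans (h : IsAncestor G r a b) (h' : IsAncestor G r b x) :
    IsAncestor G r a x := by
  obtain ⟨n, rfl⟩ := h
  obtain ⟨m, rfl⟩ := h'
  exact ⟨n + m, Function.iterate_add_apply ..⟩

theorem isAncestor_parent (x : V) : IsAncestor G r (parent G r x) x := ⟨1, rfl⟩

theorem eq_root_of_dist (hG : G.IsTree) (h : G.dist r x = 0) : x = r :=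
  ((hG.connected.dist_eq_zero_iff).1 h).symm

theorem isAncestor_root (hG : G.IsTree) (x : V) : IsAncestor G r r x :=
  ⟨G.dist r x, eq_root_of_dist hG (by rw [dist_iterate_parent hG, Nat.sub_self])⟩

theorem IsAncestor.dist_le (hG : G.IsTree) (h : IsAncestor G r a x) :
    G.dist r a ≤ G.dist r x := by
  obtain ⟨n, rfl⟩ := h
  rw [dist_iterate_parent hG]
  omega

theorem IsAncestor.eq_iterate (hG : G.IsTree) (h : IsAncestor G r a x) :
    (parent G r)^[G.dist r x - G.dist r a] x = a := by
  obtain ⟨n, rfl⟩ := h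
  rw [dist_iterate_parent hG]
  rcases le_total n (G.dist r x) with hn | hn
  · congr 2; omega
  · rw [eq_root_of_dist (x := (parent G r)^[n] x) hG (by rw [dist_iterate_parent hG]; omega)]
    exact eq_root_of_dist hG (by rw [dist_iterate_parent hG]; omega)

theorem IsAncestor.eq_of_dist (hG : G.IsTree) (h : IsAncestor G r a x)
    (hd : G.dist r x ≤ G.dist r a) : a = x := by
  have := h.eq_iterate hG
  rw [Nat.sub_eq_zero_of_le hd] at this
  exact this.symm

theorem IsAncestor.antisymm (hG : G.IsTree) (h : IsAncestor G r a x) (h' : IsAncestor G r x a) :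
    a = x :=
  h.eq_of_dist hG (h'.dist_le hG)

theorem IsAncestor.total (hG : G.IsTree) (ha : IsAncestor G r a x) (hb : IsAncestor G r b x)
    (hab : G.dist r a ≤ G.dist r b) : IsAncestor G r a b := by
  refine ⟨G.dist r b - G.dist r a, ?_⟩
  have h1 := ha.eq_iterate hG
  have h2 := hb.eq_iterate hG
  have h3 := hb.dist_le hG
  calc (parent G r)^[G.dist r b - G.dist r a] b
      = (parent G r)^[G.dist r b - G.dist r a] ((parent G r)^[G.dist r x - G.dist r b] x) := by
        rw [h2]
    _ = (parent G r)^[G.dist r x - G.dist r a] x := by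
        rw [← Function.iterate_add_apply]
        congr 2
        omega
    _ = a := h1

theorem IsAncestor.exists_dist (hG : G.IsTree) (h : IsAncestor G r a x) {j : ℕ}
    (h1 : G.dist r a ≤ j) (h2 : j ≤ G.dist r x) :
    ∃ z, IsAncestor G r a z ∧ IsAncestor G r z x ∧ G.dist r z = j := by
  have hd : G.dist r ((parent G r)^[G.dist r x - j] x) = j := by
    rw [dist_iterate_parent hG]; omega
  have hz : IsAncestor G r ((parent G r)^[G.dist r x - j] x) x := ⟨_, rfl⟩
  exact ⟨_, h.total hG hz (by omega), hz, hd⟩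

theorem IsAncestor.of_ne (h : IsAncestor G r a x) (hne : a ≠ x) :
    IsAncestor G r a (parent G r x) := by
  obtain ⟨n, rfl⟩ := h
  cases n with
  | zero => exact absurd rfl hne
  | succ n => exact ⟨n, rfl⟩

theorem IsAncestor.exists_child (hG : G.IsTree) (h : IsAncestor G r a x) (hne : a ≠ x) :
    ∃ c, parent G r c = a ∧ c ≠ r ∧ IsAncestor G r c x := by
  have hlt : G.dist r a < G.dist r x := by
    by_contra hlt
    exact hne (h.eq_of_dist hG (by omega))
  obtain ⟨c, hac, hcx, hd⟩ := h.exists_dist hG (j := G.dist r a + 1) (by omega) (by omega)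
  have hcr : c ≠ r := by
    rintro rfl
    simp at hd
  have hne' : a ≠ c := by
    rintro rfl
    omega
  have := (parent_spec hG hcr).2
  exact ⟨c, ((hac.of_ne hne').eq_of_dist hG (by omega)).symm, hcr, hcx⟩

theorem child_unique (hG : G.IsTree) (ha : a ≠ r) (hb : b ≠ r)
    (hab : parent G r a = parent G r b) (hax : IsAncestor G r a x) (hbx : IsAncestor G r b x) :
    a = b := by
  have h1 := (parent_spec hG ha).2
  have h2 := (parent_spec hG hb).2
  rw [hab] at h1
  exact (hax.total hG hbx (by omega)).eq_of_dist hG (by omega)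

/-- A walk that leaves the subtree at `a` uses the edge from `a` to its parent. -/
theorem IsAncestor.mem_support_of_exit (hG : G.IsTree) (p : G.Walk x y)
    (hx : IsAncestor G r a x) (hy : ¬ IsAncestor G r a y) :
    a ∈ p.support ∧ parent G r a ∈ p.support := by
  obtain ⟨d, hd, h1, h2⟩ := p.exists_boundary_dart {z | IsAncestor G r a z} hx hy
  rw [Set.mem_ofPred_eq] at h1 h2
  have hf := p.dart_fst_mem_support_of_mem_darts hd
  have hs := p.dart_snd_mem_support_of_mem_darts hd
  rcases parent_eq_or hG r d.adj with ⟨h, -⟩ | ⟨h, -⟩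
  · exact absurd (h1.trans (h ▸ isAncestor_parent _)) h2
  · by_cases hne : a = d.fst
    · subst hne
      exact ⟨hf, h ▸ hs⟩
    · exact absurd (h ▸ h1.of_ne hne) h2

theorem dist_add_dist_le (p : G.Walk x y) (hz : z ∈ p.support) :
    G.dist x z + G.dist z y ≤ p.length := by
  classical
  have h1 := SimpleGraph.dist_le (p.takeUntil z hz)
  have h2 := SimpleGraph.dist_le (p.dropUntil z hz)
  have h3 := congrArg Walk.length (p.take_spec hz)
  rw [Walk.length_append] at h3
  omega

theorem IsAncestor.exists_walk (hG : G.IsTree) (h : IsAncestor G r a x) :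
    ∃ p : G.Walk a x, ∀ z ∈ p.support, IsAncestor G r a z ∧ IsAncestor G r z x := by
  obtain ⟨n, hn⟩ := h
  induction n generalizing x with
  | zero =>
    obtain rfl : x = a := hn
    refine ⟨Walk.nil, fun z hz => ?_⟩
    rw [Walk.support_nil, List.mem_singleton] at hz
    subst hz
    exact ⟨.refl _, .refl _⟩
  | succ n ih =>
    by_cases hx : x = r
    · subst hx
      rw [Function.iterate_succ_apply, parent_root] at hn
      exact ih hn
    · obtain ⟨p, hp⟩ := ih hn
      have ha : IsAncestor G r a (parent G r x) := ⟨n, hn⟩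
      refine ⟨p.concat (parent_spec hG hx).1, fun z hz => ?_⟩
      rw [Walk.support_concat, List.mem_append, List.mem_singleton] at hz
      rcases hz with hz | rfl
      · exact ⟨(hp z hz).1, (hp z hz).2.trans (isAncestor_parent _)⟩
      · exact ⟨ha.trans (isAncestor_parent _), .refl _⟩

theorem IsAncestor.mem_path (hG : G.IsTree) (h : IsAncestor G r a x) (p : G.Walk a x)
    (hp : p.IsPath) (hz : z ∈ p.support) : IsAncestor G r a z ∧ IsAncestor G r z x := by
  classical
  obtain ⟨q, hq⟩ := h.exists_walk hG
  rw [(hG.existsUnique_path a x).unique hp q.bypass_isPath] at hz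
  exact hq z (q.support_bypass_subset_support hz)

theorem IsAncestor.dist_lt_dist (hG : G.IsTree) (h : IsAncestor G r a x) (hne : a ≠ x) :
    G.dist r a < G.dist r x := by
  by_contra hlt
  exact hne (h.eq_of_dist hG (by omega))

end Rooted

/-! ### Unique-maximum colourings of trees -/

section Colouring

variable {V : Type*} {G : SimpleGraph V}

/-- If the maximum of `c` on a path occurred twice, the part of the path between the two occurrences
would contain a larger colour. -/
theorem UM_le_of_ranking {M : ℕ} (c : V → ℕ) (hM : ∀ x, c x < M)
    (hc : ∀ x y, x ≠ y → c x = c y → ∀ p : G.Walk x y, ∃ z ∈ p.support, c x < c z) :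
    UM G ≤ M := by
  classical
  refine Nat.sInf_le ⟨fun x => ⟨c x, hM x⟩, ?_⟩
  rintro _ ⟨u, v, p, -, rfl⟩
  obtain ⟨z, hz, hmax⟩ := p.support.toFinset.exists_max_image c ⟨u, by simp⟩
  rw [List.mem_toFinset] at hz
  refine ⟨z, hz, fun w hw hwz => ?_⟩
  rw [Set.mem_ofPred_eq] at hw
  have hle : c w ≤ c z := hmax w (by simpa using hw)
  refine lt_of_le_of_ne hle fun heq => ?_
  have heq : c w = c z := by simpa using heq
  have hw' := hw
  rw [← p.take_spec hz, Walk.mem_support_append_iff] at hw'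
  rcases hw' with h | h
  · obtain ⟨t, ht, hlt⟩ := hc w z hwz heq ((p.takeUntil z hz).dropUntil w h)
    have := hmax t (by
      rw [List.mem_toFinset]
      exact p.support_takeUntil_subset_support hz (Walk.support_dropUntil_subset_support _ h ht))
    omega
  · obtain ⟨t, ht, hlt⟩ := hc z w hwz.symm heq.symm ((p.dropUntil z hz).takeUntil w h)
    have := hmax t (by
      rw [List.mem_toFinset]
      exact p.support_dropUntil_subset_support hz (Walk.support_takeUntil_subset_support _ h ht))
    omega

/-- Any two vertices are comparable, or lie below distinct children of a common ancestor that every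
walk between them must visit. Thus it suffices to control these two configurations. -/
theorem UM_le_of_rooted_ranking (hG : G.IsTree) (r : V) {M : ℕ} (c : V → ℕ) (hM : ∀ x, c x < M)
    (hA : ∀ x y, IsAncestor G r x y → x ≠ y → c x = c y →
      ∃ z, IsAncestor G r x z ∧ IsAncestor G r z y ∧ c x < c z)
    (hB : ∀ a b x y, a ≠ b → a ≠ r → b ≠ r → parent G r a = parent G r b →
      IsAncestor G r a x → IsAncestor G r b y → c x = c y → c x < c (parent G r a)) :
    UM G ≤ M := by
  classical
  have hA' : ∀ x y, IsAncestor G r x y → x ≠ y → c x = c y → ∀ p : G.Walk y x,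
      ∃ z ∈ p.support, c x < c z := by
    intro x y hxy hne hc p
    obtain ⟨z, h1, h2, h3⟩ := hA x y hxy hne hc
    refine ⟨z, (h2.mem_support_of_exit hG p fun h => ?_).1, h3⟩
    rw [h1.antisymm hG h] at h3
    exact lt_irrefl _ h3
  refine UM_le_of_ranking c hM fun x y hne hc p => ?_
  by_cases hxy : IsAncestor G r x y
  · obtain ⟨z, h1, h2⟩ := hA' x y hxy hne hc p.reverse
    exact ⟨z, by simpa using h1, h2⟩
  by_cases hyx : IsAncestor G r y x
  · rw [hc]
    exact hA' y x hyx hne.symm hc.symm p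
  -- The least such `n` yields the lowest common ancestor. It is positive, so the previous iterate
  -- is the child towards `x`.
  have hex : ∃ n, IsAncestor G r ((parent G r)^[n] x) y := by
    obtain ⟨n, hn⟩ := isAncestor_root hG (r := r) x
    exact ⟨n, by rw [hn]; exact isAncestor_root hG y⟩
  obtain ⟨n, hn, hmin⟩ : ∃ n, IsAncestor G r ((parent G r)^[n] x) y ∧
      ∀ m < n, ¬ IsAncestor G r ((parent G r)^[m] x) y :=
    ⟨Nat.find hex, Nat.find_spec hex, fun m hm => Nat.find_min hex hm⟩
  cases n with
  | zero => exact absurd hn hxy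
  | succ n =>
    have hax : IsAncestor G r ((parent G r)^[n] x) x := ⟨n, rfl⟩
    have hay := hmin n (Nat.lt_succ_self n)
    rw [Function.iterate_succ_apply'] at hn
    generalize (parent G r)^[n] x = a at *
    have har : a ≠ r := by
      rintro rfl
      exact hay (isAncestor_root hG y)
    have hmy : parent G r a ≠ y := by
      intro h
      exact hyx (h ▸ (isAncestor_parent a).trans hax)
    obtain ⟨b, hb, hbr, hby⟩ := hn.exists_child hG hmy
    have hab : a ≠ b := by
      rintro rfl
      exact hay hby
    exact ⟨_, (hax.mem_support_of_exit hG p hay).2,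
      hB a b x y hab har hbr hb.symm hax hby hc⟩

end Colouring

/-! ### Subdivisions in trees -/

section Subdivision

variable {V W : Type*} {G : SimpleGraph V}

theorem SimpleGraph.Subgraph.exists_coe_walk (H : G.Subgraph) {u v : V} (p : G.Walk u v)
    (hu : u ∈ H.verts) (hv : v ∈ H.verts) (he : ∀ x y, s(x, y) ∈ p.edges → H.Adj x y) :
    ∃ q : H.coe.Walk ⟨u, hu⟩ ⟨v, hv⟩, q.support.map Subtype.val = p.support ∧
      q.edges.map (Sym2.map Subtype.val) = p.edges := by
  induction p with
  | nil => exact ⟨Walk.nil, rfl, rfl⟩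
  | cons h p ih =>
    have hadj := he _ _ (by rw [Walk.edges_cons]; exact List.mem_cons_self)
    obtain ⟨q, hq, hq'⟩ := ih hadj.snd_mem hv fun x y hxy =>
      he x y (by rw [Walk.edges_cons]; exact List.mem_cons_of_mem _ hxy)
    refine ⟨Walk.cons (show H.coe.Adj ⟨_, hu⟩ ⟨_, hadj.snd_mem⟩ from hadj) q, ?_, ?_⟩
    · rw [Walk.support_cons, Walk.support_cons, List.map_cons, hq]
    · rw [Walk.edges_cons, Walk.edges_cons, List.map_cons, hq']
      rfl

/-- In a tree, a subdivision is determined by its branch vertices. -/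
theorem containsSubdivision_of_isTree (hG : G.IsTree) {B : SimpleGraph W} (br : W → V)
    (hinj : Function.Injective br)
    (hends : ∀ ⦃a b⦄, B.Adj a b → ∀ (c : W) (p : G.Walk (br a) (br b)), p.IsPath →
      br c ∈ p.support → c = a ∨ c = b)
    (hmeet : ∀ ⦃a b c d⦄, B.Adj a b → B.Adj c d → s(a, b) ≠ s(c, d) →
      ∀ (p : G.Walk (br a) (br b)) (q : G.Walk (br c) (br d)), p.IsPath → q.IsPath →
      ∀ x ∈ p.support, x ∈ q.support → x ∈ Set.range br) :
    ContainsSubdivision G B := by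
  choose P hP using fun a b => (hG.existsUnique_path (br a) (br b)).exists
  let H : G.Subgraph :=
    { verts := {x | x ∈ Set.range br ∨ ∃ a b, B.Adj a b ∧ x ∈ (P a b).support}
      Adj := fun x y => ∃ a b, B.Adj a b ∧ s(x, y) ∈ (P a b).edges
      adj_sub := fun ⟨a, b, _, h⟩ => Walk.adj_of_mem_edges _ h
      edge_vert := fun ⟨a, b, hab, h⟩ => Or.inr ⟨a, b, hab, Walk.fst_mem_support_of_mem_edges _ h⟩
      symm := ⟨fun x y ⟨a, b, hab, h⟩ => ⟨a, b, hab, Sym2.eq_swap ▸ h⟩⟩ }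
  have hbr : ∀ a, br a ∈ H.verts := fun a => Or.inl ⟨a, rfl⟩
  choose Q hQ hQ' using fun a b (hab : B.Adj a b) => H.exists_coe_walk (P a b) (hbr a) (hbr b)
    fun x y h => ⟨a, b, hab, h⟩
  have hQpath : ∀ a b (hab : B.Adj a b), (Q a b hab).IsPath := fun a b hab =>
    Walk.IsPath.mk' (List.Nodup.of_map Subtype.val ((hQ a b hab).symm ▸ (hP a b).support_nodup))
  have hsupp : ∀ a b (hab : B.Adj a b) (x : H.verts), x ∈ (Q a b hab).support ↔
      x.1 ∈ (P a b).support := by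
    intro a b hab x
    rw [← hQ a b hab]
    exact (List.mem_map_of_injective Subtype.val_injective).symm
  have hrange : ∀ x : H.verts, x.1 ∈ Set.range br → 
      x ∈ Set.range fun a => (⟨br a, hbr a⟩ : H.verts) := by
    rintro x ⟨a, ha⟩
    exact ⟨a, Subtype.ext ha⟩
  refine ⟨H, fun a => ⟨br a, hbr a⟩, fun a b hab => Q a b hab, ?_, ?_, ?_, ?_, ?_, ?_, ?_⟩
  · intro a b hab
    exact hinj (congrArg Subtype.val hab)
  · intro a b hab
    exact congrArg Subtype.val (((hG.isAcyclic.subgraph H).subsingleton_path _ _).elim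
      ⟨_, hQpath b a hab.symm⟩ ⟨_, (hQpath a b hab).reverse⟩)
  · intro a b hab
    exact hQpath a b hab
  · intro a b hab c hc
    exact hends hab c _ (hP a b) ((hsupp a b hab _).1 hc)
  · intro a b c d hab hcd hne x hx hx'
    exact hrange x (hmeet hab hcd hne _ _ (hP a b) (hP c d) x.1 ((hsupp a b hab x).1 hx)
      ((hsupp c d hcd x).1 hx'))
  · intro x
    rcases x.2 with h | ⟨a, b, hab, h⟩
    · exact Or.inl (hrange x h)
    · exact Or.inr ⟨a, b, hab, (hsupp a b hab x).2 h⟩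
  · rintro x y ⟨a, b, hab, h⟩
    refine ⟨a, b, hab, ?_⟩
    rw [← hQ' a b hab] at h
    exact (List.mem_map_of_injective (Sym2.map.injective Subtype.val_injective) (a := s(x, y))).1 h

end Subdivision

/-! ### Branches -/

section Branch

variable {V : Type*}

/-- The branch of a tree `G` that starts with the edge from `u` to `v` contains a subdivision of the
complete binary tree with `n + 1` levels, the root of which is its vertex closest to `u`. -/
inductive HasBinaryBranch (G : SimpleGraph V) : ℕ → V → V → Prop
  | leaf {u v : V} : G.Adj u v → HasBinaryBranch G 0 u v
  | pass {n : ℕ} {u v w : V} : G.Adj u v → w ≠ u → HasBinaryBranch G n v w →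
      HasBinaryBranch G n u v
  | node {n : ℕ} {u v w w' : V} : G.Adj u v → w ≠ u → w' ≠ u → w ≠ w' →
      HasBinaryBranch G n v w → HasBinaryBranch G n v w' → HasBinaryBranch G (n + 1) u v

variable {G : SimpleGraph V} {r x y z a : V} {n : ℕ}

theorem HasBinaryBranch.adj {u v : V} (h : HasBinaryBranch G n u v) : G.Adj u v := by
  cases h <;> assumption

theorem HasBinaryBranch.parent_eq {u v w : V} (hG : G.IsTree) (hu : parent G r v = u)
    (hwu : w ≠ u) (h : HasBinaryBranch G n v w) : parent G r w = v ∧ w ≠ r := by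
  rcases parent_eq_or hG r h.adj with h | ⟨h, -⟩
  · exact h
  · exact absurd (h.symm.trans hu) hwu

/-- The branch grows upwards one edge at a time by `pass`; this is what makes levels monotone along
ancestors. -/
theorem HasBinaryBranch.of_isAncestor (hG : G.IsTree) (ha : a ≠ r) (hax : IsAncestor G r a x)
    (h : HasBinaryBranch G n (parent G r x) x) : HasBinaryBranch G n (parent G r a) a := by
  obtain ⟨m, hm⟩ := hax
  induction m generalizing x with
  | zero =>
    obtain rfl : x = a := hm
    exact h
  | succ m ih =>
    refine ih ?_ hm
    by_cases hx : parent G r x = r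
    · refine absurd ?_ ha
      rw [← hm, Function.iterate_succ_apply, hx, Function.iterate_fixed parent_root]
    · refine .pass (parent_spec hG hx).1 ?_ h
      intro heq
      have h1 := (parent_spec hG hx).2
      rw [← heq] at h1
      by_cases hxr : x = r
      · exact hx (by rw [hxr, parent_root])
      · have h2 := (parent_spec hG hxr).2
        omega

/-- In the tree `G` rooted at `r`, the vertices `f s` are the branch vertices of a subdivided binary
tree with `n + 1` levels, and `g (s ++ [b])` is the child of `f s` below which `f (s ++ [b])` lies. -/
structure IsBinaryEmbedding (G : SimpleGraph V) (r : V) (n : ℕ) (f g : List Bool → V) : Prop where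
  isAncestor : ∀ s, s.length ≤ n → IsAncestor G r (g s) (f s)
  parent_eq : ∀ s b, s.length < n → parent G r (g (s ++ [b])) = f s
  ne_root : ∀ s b, s.length < n → g (s ++ [b]) ≠ r
  ne : ∀ s, s.length < n → g (s ++ [false]) ≠ g (s ++ [true])

theorem IsBinaryEmbedding.node {f g : Bool → List Bool → V}
    (h : ∀ b, IsBinaryEmbedding G r n (f b) (g b)) (hp : ∀ b, parent G r (g b []) = x)
    (hr : ∀ b, g b [] ≠ r) (hne : g false [] ≠ g true []) :
    IsBinaryEmbedding G r (n + 1) (fun | [] => x | b :: s => f b s)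
      (fun | [] => x | b :: s => g b s) where
  isAncestor
    | [], _ => .refl x
    | b :: s, hs => (h b).isAncestor s (by simpa using hs)
  parent_eq
    | [], b, _ => hp b
    | c :: s, b, hs => (h c).parent_eq s b (by simpa using hs)
  ne_root
    | [], b, _ => hr b
    | c :: s, b, hs => (h c).ne_root s b (by simpa using hs)
  ne
    | [], _ => hne
    | c :: s, hs => (h c).ne s (by simpa using hs)

theorem HasBinaryBranch.exists_node {v w w' : V} (h1 : parent G r w = v ∧ w ≠ r)
    (h2 : parent G r w' = v ∧ w' ≠ r) (hne : w ≠ w')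
    (ih1 : ∃ f g, IsBinaryEmbedding G r n f g ∧ g [] = w)
    (ih2 : ∃ f g, IsBinaryEmbedding G r n f g ∧ g [] = w') :
    ∃ f g, IsBinaryEmbedding G r (n + 1) f g ∧ g [] = v := by
  obtain ⟨f1, g1, hfg1, rfl⟩ := ih1
  obtain ⟨f2, g2, hfg2, rfl⟩ := ih2
  refine ⟨_, _, IsBinaryEmbedding.node (x := v) (f := fun b => bif b then f2 else f1)
    (g := fun b => bif b then g2 else g1) ?_ ?_ ?_ hne, rfl⟩
  · rintro (_ | _)
    exacts [hfg1, hfg2]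
  · rintro (_ | _)
    exacts [h1.1, h2.1]
  · rintro (_ | _)
    exacts [h1.2, h2.2]

theorem HasBinaryBranch.exists_isBinaryEmbedding {u v : V} (hG : G.IsTree)
    (h : HasBinaryBranch G n u v) (hu : parent G r v = u) :
    ∃ f g, IsBinaryEmbedding G r n f g ∧ g [] = v := by
  induction h with
  | @leaf u v h =>
    refine ⟨fun _ => v, fun _ => v, ⟨fun _ _ => .refl v, ?_, ?_, ?_⟩, rfl⟩ <;> simp
  | @pass n u v w h hwu hw ih =>
    obtain ⟨hvw, hwr⟩ := hw.parent_eq hG hu hwu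
    obtain ⟨f, g, hfg, rfl⟩ := ih hvw
    refine ⟨f, fun | [] => v | b :: s => g (b :: s), ⟨?_, ?_, ?_, ?_⟩, rfl⟩
    · rintro (_ | ⟨b, s⟩) hs
      · exact (hvw ▸ isAncestor_parent (g [])).trans (hfg.isAncestor [] hs)
      · exact hfg.isAncestor _ hs
    · rintro (_ | ⟨b, s⟩) c hs
      exacts [hfg.parent_eq [] c hs, hfg.parent_eq (b :: s) c hs]
    · rintro (_ | ⟨b, s⟩) c hs
      exacts [hfg.ne_root [] c hs, hfg.ne_root (b :: s) c hs]
    · rintro (_ | ⟨b, s⟩) hs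
      exacts [hfg.ne [] hs, hfg.ne (b :: s) hs]
  | @node n u v w w' h hw hw' hne h1 h2 ih1 ih2 =>
    have e1 := h1.parent_eq hG hu hw
    have e2 := h2.parent_eq hG hu hw'
    exact exists_node e1 e2 hne (ih1 e1.1) (ih2 e2.1)

namespace IsBinaryEmbedding

variable {f g : List Bool → V}

theorem isAncestor_append (hG : G.IsTree) (h : IsBinaryEmbedding G r n f g) :
    ∀ (t s : List Bool), (s ++ t).length ≤ n → IsAncestor G r (g s) (g (s ++ t))
  | [], s, _ => by rw [List.append_nil]; exact .refl _
  | b :: t, s, hs => by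
    simp only [List.length_append, List.length_cons] at hs
    have h1 := h.isAncestor s (by omega)
    have h2 := h.parent_eq s b (by omega)
    have h3 := h.isAncestor_append hG t (s ++ [b]) (by simp; omega)
    rw [List.append_assoc, List.singleton_append] at h3
    exact (h1.trans (h2 ▸ isAncestor_parent _)).trans h3

theorem isAncestor_cons (hG : G.IsTree) (h : IsBinaryEmbedding G r n f g) (s : List Bool) (b : Bool)
    (t : List Bool) (hs : (s ++ b :: t).length ≤ n) :
    IsAncestor G r (f s) (g (s ++ b :: t)) ∧ G.dist r (f s) < G.dist r (g (s ++ b :: t)) := by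
  simp only [List.length_append, List.length_cons] at hs
  have h2 := h.parent_eq s b (by omega)
  have h4 := (parent_spec hG (h.ne_root s b (by omega))).2
  have h3 := h.isAncestor_append hG t (s ++ [b]) (by simp; omega)
  rw [List.append_assoc, List.singleton_append] at h3
  have h5 := h3.dist_le hG
  rw [h2] at h4
  exact ⟨(h2 ▸ isAncestor_parent (g (s ++ [b]))).trans h3, by omega⟩

theorem false_of_diverge (hG : G.IsTree) (h : IsBinaryEmbedding G r n f g) (s t t' : List Bool)
    (b : Bool) (ht : (s ++ b :: t).length ≤ n) (ht' : (s ++ (!b) :: t').length ≤ n)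
    (h1 : IsAncestor G r (g (s ++ b :: t)) z) (h2 : IsAncestor G r (g (s ++ (!b) :: t')) z) :
    False := by
  simp only [List.length_append, List.length_cons] at ht ht'
  have e1 := h.isAncestor_append hG t (s ++ [b]) (by simp; omega)
  have e2 := h.isAncestor_append hG t' (s ++ [!b]) (by simp; omega)
  rw [List.append_assoc, List.singleton_append] at e1 e2
  have := child_unique hG (h.ne_root s b (by omega)) (h.ne_root s (!b) (by omega))
    (by rw [h.parent_eq s b (by omega), h.parent_eq s (!b) (by omega)]) (e1.trans h1) (e2.trans h2)
  have hne := h.ne s (by omega)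
  cases b
  · exact hne this
  · exact hne this.symm

end IsBinaryEmbedding

/-- Two indices are equal, one properly extends the other, or they diverge. Depth excludes unwanted
coincidences in the prefix cases, disjointness of sibling subtrees in the last. -/
theorem List.bool_trichotomy : ∀ u w : List Bool, u = w ∨ (∃ b t, w = u ++ b :: t) ∨
    (∃ b t, u = w ++ b :: t) ∨ ∃ s b t t', u = s ++ b :: t ∧ w = s ++ (!b) :: t'
  | [], [] => .inl rfl
  | [], b :: t => .inr (.inl ⟨b, t, rfl⟩)
  | b :: t, [] => .inr (.inr (.inl ⟨b, t, rfl⟩))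
  | b :: u, c :: w => by
    by_cases hbc : c = b
    · subst hbc
      rcases List.bool_trichotomy u w with rfl | ⟨b, t, rfl⟩ | ⟨b, t, rfl⟩ | ⟨s, b, t, t', rfl, rfl⟩
      · exact .inl rfl
      · exact .inr (.inl ⟨b, t, rfl⟩)
      · exact .inr (.inr (.inl ⟨b, t, rfl⟩))
      · exact .inr (.inr (.inr ⟨c :: s, b, t, t', rfl, rfl⟩))
    · have : c = !b := by cases b <;> cases c <;> simp_all
      exact .inr (.inr (.inr ⟨[], b, u, w, rfl, by rw [this]; rfl⟩))

namespace IsBinaryEmbedding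

variable {f g : List Bool → V}

/-- A branch vertex below `g u` has an index that extends `u`. -/
theorem exists_append_of_isAncestor (hG : G.IsTree) (h : IsBinaryEmbedding G r n f g)
    {u w : List Bool} (hu : u.length ≤ n) (hw : w.length ≤ n) (hz : IsAncestor G r (g u) (f w)) :
    ∃ t, w = u ++ t := by
  rcases List.bool_trichotomy u w with rfl | ⟨b, t, rfl⟩ | ⟨b, t, rfl⟩ | ⟨s, b, t, t', rfl, rfl⟩
  · exact ⟨[], by simp⟩
  · exact ⟨b :: t, rfl⟩
  · have := (h.isAncestor_cons hG w b t hu).2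
    have := hz.dist_le hG
    omega
  · exact (h.false_of_diverge hG s t t' b hu hw hz (h.isAncestor _ hw)).elim

theorem eq_of_isAncestor (hG : G.IsTree) (h : IsBinaryEmbedding G r n f g)
    {u w : List Bool} (hu : u.length ≤ n) (hw : w.length ≤ n) (hz : IsAncestor G r (g u) (f w))
    (hz' : IsAncestor G r (f w) (f u)) : w = u := by
  obtain ⟨_ | ⟨b, t⟩, rfl⟩ := h.exists_append_of_isAncestor hG hu hw hz
  · simp
  · have h1 := (h.isAncestor_cons hG u b t hw).2
    have h2 := (h.isAncestor _ hw).dist_le hG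
    have h3 := hz'.dist_le hG
    omega

/-- Apart from its upper end, a branch path lies in the segment from `g` to `f` at the index of its
lower end. Disjointness of branch paths thus reduces to that of these segments, `eq_of_mem_paths`.
-/
theorem mem_path (hG : G.IsTree) (h : IsBinaryEmbedding G r n f g) {s : List Bool} {b : Bool}
    (hs : s.length < n) (p : G.Walk (f s) (f (s ++ [b]))) (hp : p.IsPath) (hz : z ∈ p.support) :
    z = f s ∨ IsAncestor G r (g (s ++ [b])) z ∧ IsAncestor G r z (f (s ++ [b])) := by
  have hs' : (s ++ [b]).length ≤ n := by simpa using hs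
  have h1 := h.isAncestor _ hs'
  obtain ⟨h2, h3⟩ := ((h.isAncestor_cons hG s b [] hs').1.trans h1).mem_path hG p hp hz
  refine or_iff_not_imp_left.2 fun hne => ⟨?_, h3⟩
  obtain ⟨c, hc, hcr, hcz⟩ := h2.exists_child hG (Ne.symm hne)
  rw [child_unique hG (h.ne_root s b hs) hcr ((h.parent_eq s b hs).trans hc.symm) h1
    (hcz.trans h3)]
  exact hcz

theorem eq_of_mem_paths (hG : G.IsTree) (h : IsBinaryEmbedding G r n f g) {u w : List Bool}
    (hu : u.length ≤ n) (hw : w.length ≤ n)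
    (h1 : IsAncestor G r (g u) z) (h2 : IsAncestor G r z (f u))
    (h3 : IsAncestor G r (g w) z) (h4 : IsAncestor G r z (f w)) : u = w := by
  rcases List.bool_trichotomy u w with rfl | ⟨b, t, rfl⟩ | ⟨b, t, rfl⟩ | ⟨s, b, t, t', rfl, rfl⟩
  · rfl
  · have := (h.isAncestor_cons hG u b t hw).2
    have := h3.dist_le hG
    have := h2.dist_le hG
    omega
  · have := (h.isAncestor_cons hG w b t hu).2
    have := h1.dist_le hG
    have := h4.dist_le hG
    omega
  · exact (h.false_of_diverge hG s t t' b hu hw h1 h3).elim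

theorem containsSubdivision (hG : G.IsTree) (h : IsBinaryEmbedding G r n f g) :
    ContainsSubdivision G (completeBinaryTree (n + 1)) := by
  have hlen : ∀ a : {s : List Bool // s.length < n + 1}, a.1.length ≤ n := fun a =>
    Nat.le_of_lt_succ a.2
  refine containsSubdivision_of_isTree hG (fun a => f a.1) ?_ ?_ ?_
  · intro a b hab
    have hab : f a.1 = f b.1 := hab
    have ha := h.isAncestor _ (hlen a)
    rw [hab] at ha
    exact Subtype.ext (h.eq_of_isAncestor hG (hlen a) (hlen b) ha (hab ▸ .refl _)).symm
  · have key : ∀ (a b c : {s : List Bool // s.length < n + 1}) (i : Bool), b.1 = a.1 ++ [i] →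
        ∀ p : G.Walk (f a.1) (f b.1), p.IsPath → f c.1 ∈ p.support → c = a ∨ c = b := by
      rintro ⟨s, hs⟩ ⟨_, hb⟩ ⟨w, hw⟩ i rfl p hp hc
      simp only [List.length_append, List.length_singleton] at hb
      rcases h.mem_path hG (show s.length < n by omega) p hp hc with hc | ⟨h1, h2⟩
      · left
        have hc : f w = f s := hc
        have ha := h.isAncestor w (by omega)
        rw [hc] at ha
        exact Subtype.ext (h.eq_of_isAncestor hG (u := w) (w := s) (by omega) (by omega) ha
          (hc ▸ .refl _)).symm
      · right
        exact Subtype.ext (h.eq_of_isAncestor hG (by simp; omega) (show w.length ≤ n by omega) h1 h2)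
    rintro a b ⟨i, hi | hi⟩ c p hp hc
    · exact key a b c i hi p hp hc
    · exact (key b a c i hi p.reverse hp.reverse (by simpa using hc)).symm
  · have key : ∀ (a b c d : {s : List Bool // s.length < n + 1}) (i j : Bool), b.1 = a.1 ++ [i] →
        d.1 = c.1 ++ [j] → s(a, b) ≠ s(c, d) → ∀ (p : G.Walk (f a.1) (f b.1))
        (q : G.Walk (f c.1) (f d.1)), p.IsPath → q.IsPath → ∀ x ∈ p.support, x ∈ q.support →
        x ∈ Set.range fun a : {s : List Bool // s.length < n + 1} => f a.1 := by
      rintro ⟨s, hs⟩ ⟨_, hb⟩ ⟨t, ht⟩ ⟨_, hd⟩ i j rfl rfl hne p q hp hq x hx hx'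
      simp only [List.length_append, List.length_singleton] at hb hd
      rcases h.mem_path hG (show s.length < n by omega) p hp hx with hx | ⟨h1, h2⟩
      · exact ⟨⟨s, hs⟩, hx.symm⟩
      rcases h.mem_path hG (show t.length < n by omega) q hq hx' with hx | ⟨h3, h4⟩
      · exact ⟨⟨t, ht⟩, hx.symm⟩
      refine absurd ?_ hne
      have := h.eq_of_mem_paths hG (by simp; omega) (by simp; omega) h1 h2 h3 h4
      obtain ⟨rfl, hij⟩ := List.append_inj' this rfl
      obtain rfl : i = j := by simpa using hij
      rfl
    rintro a b c d ⟨i, hi | hi⟩ ⟨j, hj | hj⟩ hne p q hp hq x hx hx'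
    · exact key a b c d i j hi hj hne p q hp hq x hx hx'
    · exact key a b d c i j hi hj (by rwa [Sym2.eq_swap (a := d)]) p q.reverse hp hq.reverse x hx
        (by simpa using hx')
    · exact key b a c d i j hi hj (by rwa [Sym2.eq_swap (a := b)]) p.reverse q hp.reverse hq x
        (by simpa using hx) hx'
    · exact key b a d c i j hi hj (by rwa [Sym2.eq_swap (a := b), Sym2.eq_swap (a := d)])
        p.reverse q.reverse hp.reverse hq.reverse x (by simpa using hx) (by simpa using hx')

end IsBinaryEmbedding

/-- Rooting at `m` itself makes both branches point away from the root, so `m` can serve as the top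
node. -/
theorem HasBinaryBranch.containsSubdivision {m w w' : V} (hG : G.IsTree) (hne : w ≠ w')
    (h : HasBinaryBranch G n m w) (h' : HasBinaryBranch G n m w') :
    ContainsSubdivision G (completeBinaryTree (n + 2)) := by
  have key : ∀ w, HasBinaryBranch G n m w → parent G m w = m ∧ w ≠ m := by
    intro w hw
    rcases parent_eq_or hG m hw.adj with h | ⟨-, h⟩
    · exact h
    · exact absurd rfl h
  obtain ⟨f, g, hfg, -⟩ := exists_node (key w h) (key w' h') hne
    (h.exists_isBinaryEmbedding hG (key w h).1) (h'.exists_isBinaryEmbedding hG (key w' h').1)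
  exact hfg.containsSubdivision hG

end Branch

/-! ### The ruler sequence -/

theorem padicValNat_two_lt {a l : ℕ} (ha : 0 < a) (hal : a < 2 ^ l) : padicValNat 2 a < l := by
  have h := Nat.le_of_dvd ha (pow_padicValNat_dvd (p := 2) (n := a))
  exact (Nat.pow_lt_pow_iff_right one_lt_two).1 (h.trans_lt hal)

/-- Both numbers are odd multiples of the same `2 ^ n`, so an even multiple lies strictly between
them. -/
theorem exists_between_padicValNat_two {a b : ℕ} (ha : 0 < a) (hab : a < b)
    (h : padicValNat 2 a = padicValNat 2 b) :
    ∃ c, a < c ∧ c < b ∧ padicValNat 2 a < padicValNat 2 c := by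
  have hna := pow_succ_padicValNat_not_dvd (p := 2) ha.ne'
  have hnb := pow_succ_padicValNat_not_dvd (p := 2) (ha.trans hab).ne'
  obtain ⟨a', ha'⟩ := pow_padicValNat_dvd (p := 2) (n := a)
  obtain ⟨b', hb'⟩ := pow_padicValNat_dvd (p := 2) (n := b)
  rw [← h] at hnb hb'
  generalize padicValNat 2 a = n at *
  have hpos : 0 < 2 ^ n := by positivity
  have hodd : ∀ t, ¬ 2 ^ (n + 1) ∣ 2 ^ n * t → t % 2 = 1 := by
    intro t ht
    by_contra hne
    exact ht (by rw [pow_succ]; exact Nat.mul_dvd_mul_left _ (Nat.dvd_of_mod_eq_zero (by omega)))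
  have h1 := hodd a' (ha' ▸ hna)
  have h2 := hodd b' (hb' ▸ hnb)
  have h3 : a' < b' := by
    rw [ha', hb'] at hab
    exact lt_of_mul_lt_mul_left hab hpos.le
  refine ⟨2 ^ n * (a' + 1), ?_, ?_, ?_⟩
  · conv_lhs => rw [ha']
    exact Nat.mul_lt_mul_of_pos_left (Nat.lt_succ_self _) hpos
  · conv_rhs => rw [hb']
    exact Nat.mul_lt_mul_of_pos_left (by omega) hpos
  · refine (padicValNat_dvd_iff_le (p := 2) (n := n + 1) (Nat.mul_pos hpos (Nat.succ_pos _)).ne').1 ?_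
    rw [pow_succ]
    exact Nat.mul_dvd_mul_left _ (Nat.dvd_of_mod_eq_zero (by omega))

/-! ### Chains of equal level in a rooted tree -/

section Chain

variable {V : Type*} {G : SimpleGraph V} {r x y a : V} {lam : V → ℕ}

/-- The depth of the topmost ancestor of `x` that has the same level as `x`. -/
noncomputable def chainTop (G : SimpleGraph V) (r : V) (lam : V → ℕ) (x : V) : ℕ :=
  sInf {d | ∃ a, IsAncestor G r a x ∧ lam a = lam x ∧ d = G.dist r a}

/-- The position of `x` among its ancestors of the same level, counted from the top. -/
noncomputable def chainIndex (G : SimpleGraph V) (r : V) (lam : V → ℕ) (x : V) : ℕ :=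
  G.dist r x + 1 - chainTop G r lam x

theorem chainTop_le (h : IsAncestor G r a x) (hlam : lam a = lam x) :
    chainTop G r lam x ≤ G.dist r a :=
  Nat.sInf_le ⟨a, h, hlam, rfl⟩

theorem exists_chainTop (G : SimpleGraph V) (r : V) (lam : V → ℕ) (x : V) :
    ∃ a, IsAncestor G r a x ∧ lam a = lam x ∧ chainTop G r lam x = G.dist r a :=
  Nat.sInf_mem (s := {d | ∃ a, IsAncestor G r a x ∧ lam a = lam x ∧ d = G.dist r a})
    ⟨_, x, .refl x, rfl, rfl⟩

theorem chainIndex_pos : 0 < chainIndex G r lam x := by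
  have := chainTop_le (G := G) (r := r) (lam := lam) (.refl x) rfl
  rw [chainIndex]
  omega

theorem chainTop_eq (hG : G.IsTree) (h : IsAncestor G r x y) (hlam : lam x = lam y) :
    chainTop G r lam y = chainTop G r lam x := by
  apply le_antisymm
  · obtain ⟨a, ha, hax, hd⟩ := exists_chainTop G r lam x
    exact hd ▸ chainTop_le (ha.trans h) (hax.trans hlam)
  · obtain ⟨a, ha, hay, hd⟩ := exists_chainTop G r lam y
    rw [hd]
    rcases le_total (G.dist r a) (G.dist r x) with hle | hle
    · exact chainTop_le (ha.total hG h hle) (hay.trans hlam.symm)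
    · exact (chainTop_le (.refl x) rfl).trans hle

theorem IsAncestor.level_le (hlam : ∀ x, lam x ≤ lam (parent G r x)) (h : IsAncestor G r a x) :
    lam x ≤ lam a := by
  obtain ⟨n, rfl⟩ := h
  induction n with
  | zero => exact le_rfl
  | succ n ih =>
    rw [Function.iterate_succ_apply']
    exact ih.trans (hlam _)

theorem chainIndex_lt (hG : G.IsTree) {m : ℕ} (hm : ∀ x y, G.dist x y + 1 < m) (x : V) :
    chainIndex G r lam x < m := by
  obtain ⟨a, -, -, hd⟩ := exists_chainTop G r lam x
  have h1 := hG.connected.dist_triangle (u := r) (v := a) (w := x)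
  have h2 := hm a x
  rw [chainIndex]
  omega

/-- By monotonicity every vertex between `x` and `y` has their level. Hence the chain has no gaps,
every intermediate index is attained, and the ruler sequence applies. -/
theorem exists_chain_between (hG : G.IsTree) (hlam : ∀ x, lam x ≤ lam (parent G r x))
    (h : IsAncestor G r x y) (hne : x ≠ y) (hxy : lam x = lam y)
    (hv : padicValNat 2 (chainIndex G r lam x) = padicValNat 2 (chainIndex G r lam y)) :
    ∃ z, IsAncestor G r x z ∧ IsAncestor G r z y ∧ lam z = lam x ∧
      padicValNat 2 (chainIndex G r lam x) < padicValNat 2 (chainIndex G r lam z) := by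
  have hd := h.dist_lt_dist hG hne
  have ht := chainTop_eq hG h hxy
  have htx := chainTop_le (G := G) (r := r) (lam := lam) (.refl x) rfl
  obtain ⟨c, hxc, hcy, hc⟩ := exists_between_padicValNat_two (chainIndex_pos (x := x))
    (show chainIndex G r lam x < chainIndex G r lam y by rw [chainIndex, chainIndex]; omega) hv
  rw [chainIndex] at hxc hcy
  obtain ⟨z, h1, h2, h3⟩ := h.exists_dist hG (j := c + chainTop G r lam x - 1)
    (by omega) (by omega)
  have hz : lam z = lam x :=
    le_antisymm (h1.level_le hlam) (hxy.le.trans (h2.level_le hlam))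
  have htz := chainTop_eq hG h1 hz.symm
  refine ⟨z, h1, h2, hz, ?_⟩
  rwa [show chainIndex G r lam z = c by rw [chainIndex]; omega]

end Chain

/-! ### Colouring a tree without large branches off an edge -/

section Bound

variable {V : Type*} {G : SimpleGraph V} {p v x : V} {e : ℕ}

/-- The level of a vertex of a tree rooted at `p`: for `x ≠ p, v` the largest `n ≤ e` such that the
branch at `x` contains a binary tree with `n + 1` levels. -/
noncomputable def branchLevel (G : SimpleGraph V) (p v : V) (e : ℕ) (x : V) : ℕ :=
  open Classical in
  if x = p then e + 1 else if x = v then e else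
    Nat.findGreatest (fun n => HasBinaryBranch G n (parent G p x) x) e

open Classical in
theorem branchLevel_of_ne (hp : x ≠ p) (hv : x ≠ v) : branchLevel G p v e x =
    Nat.findGreatest (fun n => HasBinaryBranch G n (parent G p x) x) e := by
  rw [branchLevel, if_neg hp, if_neg hv]

theorem branchLevel_le (hp : x ≠ p) : branchLevel G p v e x ≤ e := by
  classical
  rw [branchLevel, if_neg hp]
  split_ifs
  · exact le_rfl
  · exact Nat.findGreatest_le _

theorem hasBinaryBranch_branchLevel (hG : G.IsTree) (hp : x ≠ p) (hv : x ≠ v) :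
    HasBinaryBranch G (branchLevel G p v e x) (parent G p x) x := by
  classical
  rw [branchLevel_of_ne hp hv]
  exact Nat.findGreatest_spec (P := fun n => HasBinaryBranch G n (parent G p x) x)
    (Nat.zero_le e) (.leaf (parent_spec hG hp).1)

theorem le_branchLevel {n : ℕ} (hp : x ≠ p) (hn : n ≤ e)
    (h : HasBinaryBranch G n (parent G p x) x) : n ≤ branchLevel G p v e x := by
  classical
  by_cases hv : x = v
  · rw [branchLevel, if_neg hp, if_pos hv]
    exact hn
  · rw [branchLevel_of_ne hp hv]
    exact Nat.le_findGreatest hn h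

/-- A large branch at `x` would extend upwards to a child of `p`, necessarily `v`, and then also to
a child of `v`. -/
theorem not_hasBinaryBranch_parent (hG : G.IsTree) (hpv : G.Adj p v)
    (hv : ∀ w, w ≠ p → ¬ HasBinaryBranch G e v w) (hp : ∀ w, w ≠ v → ¬ HasBinaryBranch G e p w)
    (hxp : x ≠ p) (hxv : x ≠ v) : ¬ HasBinaryBranch G e (parent G p x) x := by
  intro h
  obtain ⟨c, hc, hcp, hcx⟩ := (isAncestor_root hG x).exists_child hG (Ne.symm hxp)
  have h1 := h.of_isAncestor hG hcp hcx
  rw [hc] at h1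
  obtain rfl : c = v := by
    by_contra hne
    exact hp c hne h1
  obtain ⟨d, hd, hdp, hdx⟩ := hcx.exists_child hG (Ne.symm hxv)
  have h2 := h.of_isAncestor hG hdp hdx
  rw [hd] at h2
  exact hv d hdp h2

/-- The colours `N + 1` and `N` go to `p` and `v`, and `l * level + ruler value` to all others. The
colour `N` of `v` has to dominate only the vertices below `v`, since `p` separates the other side.
The second alternative of `hN'` exploits this with one colour fewer when the side of `v` is shallow.
-/
theorem UM_le_of_branches (hG : G.IsTree) {l N : ℕ} (hpv : G.Adj p v)
    (hl : ∀ x y, G.dist x y + 1 < 2 ^ l)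
    (hv : ∀ w, w ≠ p → ¬ HasBinaryBranch G e v w) (hp : ∀ w, w ≠ v → ¬ HasBinaryBranch G e p w)
    (hN : l * e ≤ N + 1)
    (hN' : l * e ≤ N ∨ e = 1 ∧ ∀ x, IsAncestor G p v x → G.dist p x ≤ 2 ^ N) :
    UM G ≤ N + 2 := by
  classical
  have hvp : parent G p v = p ∧ v ≠ p := by
    rcases parent_eq_or hG p hpv with h | ⟨-, h⟩
    · exact h
    · exact absurd rfl h
  set lam := branchLevel G p v e with hlamdef
  have hlp : lam p = e + 1 := if_pos rfl
  have hlv : lam v = e := by rw [hlamdef, branchLevel, if_neg hvp.2, if_pos rfl]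
  have hlt : ∀ x, x ≠ p → x ≠ v → lam x < e := by
    intro x hxp hxv
    refine lt_of_le_of_ne (branchLevel_le hxp) fun h => ?_
    exact not_hasBinaryBranch_parent hG hpv hv hp hxp hxv
      (h ▸ hasBinaryBranch_branchLevel hG hxp hxv)
  have hmono : ∀ x, lam x ≤ lam (parent G p x) := by
    intro x
    by_cases hxp : x = p
    · rw [hxp, parent_root]
    by_cases hpp : parent G p x = p
    · rw [hpp, hlp]
      exact (branchLevel_le hxp).trans (Nat.le_succ e)
    by_cases hxv : x = v
    · exact absurd (hxv ▸ hvp.1) hpp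
    · exact le_branchLevel hpp (branchLevel_le hxp)
        ((hasBinaryBranch_branchLevel hG hxp hxv).of_isAncestor hG hpp (isAncestor_parent x))
  set ν : V → ℕ := fun x => padicValNat 2 (chainIndex G p lam x) with hν
  have hνl : ∀ x, ν x < l := fun x => padicValNat_two_lt chainIndex_pos (chainIndex_lt hG hl x)
  set c : V → ℕ := fun x => if x = p then N + 1 else if x = v then N else l * lam x + ν x with hc
  have hcp : c p = N + 1 := if_pos rfl
  have hcv : c v = N := by rw [hc]; simp only [if_neg hvp.2, if_true]
  have hcx : ∀ x, x ≠ p → x ≠ v → c x = l * lam x + ν x := by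
    intro x hxp hxv
    simp only [hc, if_neg hxp, if_neg hxv]
  have hstep : ∀ x s, lam x < s → l * lam x + ν x < l * s := by
    intro x s hs
    have h1 := Nat.mul_le_mul_left l (Nat.succ_le_of_lt hs)
    have h2 := hνl x
    rw [Nat.mul_succ] at h1
    omega
  have hcN : ∀ x, x ≠ p → c x ≤ N := by
    intro x hxp
    by_cases hxv : x = v
    · rw [hxv, hcv]
    · rw [hcx x hxp hxv]
      have := hstep x e (hlt x hxp hxv)
      omega
  have hsub : ∀ x, x ≠ v → IsAncestor G p v x → c x < N := by
    intro x hxv hvx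
    have hxp : x ≠ p := by
      rintro rfl
      exact hvp.2 (hvx.antisymm hG (isAncestor_root hG v))
    rw [hcx x hxp hxv]
    have h1 := hlt x hxp hxv
    rcases hN' with h | ⟨he, h⟩
    · exact (hstep x e h1).trans_le h
    · have h0 : lam x = 0 := by omega
      rw [h0, Nat.mul_zero, Nat.zero_add]
      refine padicValNat_two_lt chainIndex_pos ?_
      -- Since `v` has level 1, the chain of `x` starts strictly below `v`, at depth at least 2. So
      -- its index is at most `G.dist p x - 1 < 2 ^ N`.
      obtain ⟨a, hax, ha, hd⟩ := exists_chainTop G p lam x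
      have hva : G.dist p v < G.dist p a := by
        by_contra hle
        have := (hax.total hG hvx (by omega)).level_le hmono
        omega
      have hd1 := (parent_spec hG hvp.2).2
      have := h x hvx
      have hpos : 0 < 2 ^ N := by positivity
      rw [chainIndex]
      omega
  have hkey : ∀ x y, x ≠ p → x ≠ v → y ≠ p → y ≠ v → c x = c y → lam x = lam y ∧ ν x = ν y := by
    intro x y hxp hxv hyp hyv hxy
    rw [hcx x hxp hxv, hcx y hyp hyv] at hxy
    have h1 : lam x = lam y := by
      rcases lt_trichotomy (lam x) (lam y) with h | h | h
      · have := hstep x _ h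
        omega
      · exact h
      · have := hstep y _ h
        omega
    rw [h1] at hxy
    exact ⟨h1, by omega⟩
  refine UM_le_of_rooted_ranking hG p c ?_ ?_ ?_
  · intro x
    by_cases hxp : x = p
    · rw [hxp, hcp]; omega
    · have := hcN x hxp
      omega
  · intro x y hxy hne hcxy
    have hyp : y ≠ p := by
      rintro rfl
      exact hne (hxy.antisymm hG (isAncestor_root hG x))
    have hxp : x ≠ p := by
      rintro rfl
      have := hcN y hyp
      omega
    have hxv : x ≠ v := by
      rintro rfl
      have := hsub y hne.symm hxy
      omega
    have hyv : y ≠ v := by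
      rintro rfl
      have h1 := hxy.of_ne hne
      rw [hvp.1] at h1
      exact hxp (h1.antisymm hG (isAncestor_root hG x))
    obtain ⟨h1, h2⟩ := hkey x y hxp hxv hyp hyv hcxy
    obtain ⟨z, hxz, hzy, hz, hlt'⟩ := exists_chain_between hG hmono hxy hne h1 h2
    have h3 := hlt x hxp hxv
    refine ⟨z, hxz, hzy, ?_⟩
    rw [hcx x hxp hxv, hcx z (by rintro rfl; omega) (by rintro rfl; omega), hz]
    exact Nat.add_lt_add_left hlt' _
  · intro a b x y hab hap hbp hpar hax hby hcxy
    have hroot : ∀ a x, a ≠ p → IsAncestor G p a x → x ≠ p := by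
      rintro a x ha hax rfl
      exact ha (hax.antisymm hG (isAncestor_root hG a))
    have hxp := hroot a x hap hax
    have hyp := hroot b y hbp hby
    by_cases hmp : parent G p a = p
    · rw [hmp, hcp]
      have := hcN x hxp
      omega
    have hnv : ∀ a x, a ≠ p → parent G p a ≠ p → IsAncestor G p a x → x ≠ v := by
      rintro a x ha hpa hax rfl
      by_cases heq : a = x
      · exact hpa (heq ▸ hvp.1)
      · have := hax.of_ne heq
        rw [hvp.1] at this
        exact ha (this.antisymm hG (isAncestor_root hG a))
    have hxv := hnv a x hap hmp hax
    have hyv := hnv b y hbp (hpar ▸ hmp) hby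
    by_cases hmv : parent G p a = v
    · rw [hmv, hcv]
      exact hsub x hxv (hmv ▸ (isAncestor_parent a).trans hax)
    obtain ⟨h1, -⟩ := hkey x y hxp hxv hyp hyv hcxy
    have hx := (hasBinaryBranch_branchLevel (e := e) hG hxp hxv).of_isAncestor hG hap hax
    have hy := (hasBinaryBranch_branchLevel (e := e) hG hyp hyv).of_isAncestor hG hbp hby
    rw [← hlamdef, ← h1, ← hpar] at hy
    rw [← hlamdef] at hx
    have hm := parent_spec hG hmp
    have hpp : ∀ b, b ≠ p → parent G p b = parent G p a → b ≠ parent G p (parent G p a) := by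
      intro b hb hba heq
      have h5 := (parent_spec hG hb).2
      rw [hba] at h5
      rw [← heq] at hm
      omega
    -- Both children carry a branch of the level of `x`, so their parent has a strictly higher
    -- level, and hence a larger colour.
    have hnode := HasBinaryBranch.node hm.1 (hpp a hap rfl) (hpp b hbp hpar.symm) hab hx hy
    have h6 : lam x + 1 ≤ lam (parent G p a) :=
      le_branchLevel hmp (hlt x hxp hxv) hnode
    rw [hcx x hxp hxv, hcx _ hmp hmv]
    exact (hstep x _ h6).trans_le (Nat.le_add_right _ _)

/-- If no vertex has two large branches, some edge is such that no other branch at its ends is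
large. -/
theorem exists_adj_no_large_branch [Finite V] [Nontrivial V] (hG : G.IsTree)
    (h : ∀ m w w', HasBinaryBranch G e m w → HasBinaryBranch G e m w' → w = w') :
    ∃ p v, G.Adj p v ∧ (∀ w, w ≠ p → ¬ HasBinaryBranch G e v w) ∧
      ∀ w, w ≠ v → ¬ HasBinaryBranch G e p w := by
  classical
  obtain ⟨r⟩ := hG.connected.nonempty
  by_cases hD : ∃ x, x ≠ r ∧ HasBinaryBranch G e (parent G r x) x
  -- Take a deepest large branch pointing away from `r`. Maximality excludes large branches below
  -- `x`, and the hypothesis excludes a second one at its parent.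
  · obtain ⟨x, ⟨hxr, hx⟩, hmax⟩ := Set.exists_max_image
      {x | x ≠ r ∧ HasBinaryBranch G e (parent G r x) x} (G.dist r) (Set.toFinite _) hD
    refine ⟨parent G r x, x, hx.adj, fun w hw hxw => ?_, fun w hw hxw => hw (h _ _ _ hxw hx)⟩
    obtain ⟨h1, h2⟩ := hxw.parent_eq hG rfl hw
    have h3 := hmax w ⟨h2, by rwa [h1]⟩
    have h4 := (parent_spec hG h2).2
    rw [h1] at h4
    omega
  -- No large branch points away from `r`, so any edge at `r` will do.
  · obtain ⟨q, hq⟩ := hG.connected.preconnected.exists_adj_of_nontrivial r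
    have hq' : parent G r q = r := by
      rcases parent_eq_or hG r hq with h | ⟨-, h⟩
      · exact h.1
      · exact absurd rfl h
    refine ⟨r, q, hq, fun w hw hqw => ?_, fun w hw hrw => ?_⟩
    · obtain ⟨h1, h2⟩ := hqw.parent_eq hG hq' hw
      exact hD ⟨w, h2, by rwa [h1]⟩
    · rcases parent_eq_or hG r hrw.adj with ⟨h1, h2⟩ | ⟨-, h⟩
      · exact hD ⟨w, h2, by rwa [h1]⟩
      · exact absurd rfl h

theorem dist_add_dist_le_of_isAncestor {r a x : V} (hG : G.IsTree) (hx : IsAncestor G r a x)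
    (ha : a ≠ r) : G.dist r a + G.dist a x ≤ G.dist r x := by
  obtain ⟨q, hq⟩ := hG.connected.exists_walk_length_eq_dist r x
  have h := (hx.mem_support_of_exit hG q.reverse
    fun h => ha (h.antisymm hG (isAncestor_root hG a))).1
  have := dist_add_dist_le q (by simpa using h)
  omega

/-- For `e = 1` the saving needs one side of the edge `pv` to be shallow. If both were deep, two far
vertices on opposite sides would violate `hl`; so `p` and `v` can be swapped if necessary. -/
theorem UM_le_of_no_large_branch [Finite V] [Nontrivial V] (hG : G.IsTree) {l : ℕ}
    (hl : ∀ x y, G.dist x y + 1 < 2 ^ l)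
    (h : ∀ m w w', HasBinaryBranch G e m w → HasBinaryBranch G e m w' → w = w') :
    UM G ≤ l * e + 2 ∧ (e = 1 → UM G ≤ l + 1) := by
  obtain ⟨p, v, hpv, hv, hp⟩ := exists_adj_no_large_branch hG h
  refine ⟨UM_le_of_branches hG hpv hl hv hp (Nat.le_succ _) (.inl le_rfl), ?_⟩
  rintro rfl
  cases l with
  | zero =>
    have := hl p p
    omega
  | succ N =>
    by_cases hs : ∀ x, IsAncestor G p v x → G.dist p x ≤ 2 ^ N
    · exact UM_le_of_branches hG hpv hl hv hp (by omega) (.inr ⟨rfl, hs⟩)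
    refine UM_le_of_branches hG hpv.symm hl hp hv (by omega) (.inr ⟨rfl, fun y hy => ?_⟩)
    by_contra hlt
    push Not at hs hlt
    obtain ⟨x, hx, hx'⟩ := hs
    have hvp : parent G p v = p := by
      rcases parent_eq_or hG p hpv with h | ⟨-, h⟩
      · exact h.1
      · exact absurd rfl h
    have e1 : G.dist p v = 1 := dist_eq_one_iff_adj.2 hpv
    have e2 : G.dist v p = 1 := dist_eq_one_iff_adj.2 hpv.symm
    have h1 := dist_add_dist_le_of_isAncestor hG hy hpv.ne
    have hvy : ¬ IsAncestor G p v y := by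
      intro hvy
      have := dist_add_dist_le_of_isAncestor hG hvy hpv.ne'
      omega
    obtain ⟨q, hq⟩ := hG.connected.exists_walk_length_eq_dist x y
    have h2 := (hx.mem_support_of_exit hG q hvy).2
    rw [hvp] at h2
    have h3 := dist_add_dist_le q h2
    have h4 := hG.connected.dist_triangle (u := v) (v := p) (w := y)
    have h5 := hl x y
    rw [dist_comm] at h3
    rw [pow_succ] at h5
    omega

end Bound

theorem containsPath_of_le_dist {V : Type*} {G : SimpleGraph V} (hG : G.Connected) {n : ℕ}
    (hn : 0 < n) {x y : V} (h : n ≤ G.dist x y + 1) : ContainsPath G n := by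
  obtain ⟨p, hp, hl⟩ := hG.exists_path_of_dist x y
  refine ⟨_, _, p.take (n - 1), hp.take _, ?_⟩
  rw [Walk.length_support, Walk.take_length, hl]
  omega

theorem UM_le_one_of_subsingleton {V : Type*} [Subsingleton V] (G : SimpleGraph V) : UM G ≤ 1 :=
  UM_le_of_ranking (fun _ => 0) (fun _ => Nat.zero_lt_one)
    fun x y hxy => absurd (Subsingleton.elim x y) hxy

theorem mainTheorem5 {V : Type*} [Finite V] (T : SimpleGraph V) (hT : T.IsTree) (k l : ℕ)
    (hk : 3 ≤ k) (hcrit : IsKUMCritical k T) :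
    ContainsPath T (2 ^ l) ∨
      ContainsSubdivision T (completeBinaryTree ⌈((k : ℚ) + l + 3) / ((l : ℚ) + 2)⌉₊) := by
  have hUM : UM T = k := hcrit.2
  have : Nontrivial V := by
    by_contra h
    rw [not_nontrivial_iff_subsingleton] at h
    have := UM_le_one_of_subsingleton T
    omega
  have hl0 : (0 : ℚ) < (l : ℚ) + 2 := by positivity
  set s := ⌈((k : ℚ) + l + 3) / ((l : ℚ) + 2)⌉₊ with hs
  have hs2 : 1 < s := by
    rw [hs, Nat.lt_ceil, lt_div_iff₀ hl0]
    push_cast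
    linarith [(Nat.cast_nonneg k : (0 : ℚ) ≤ k)]
  obtain ⟨e, he⟩ : ∃ e, s = e + 2 := ⟨s - 2, by omega⟩
  -- From `e + 1 < s` the ceiling gives `(e + 1) * (l + 2) < k + l + 3`, which is `e * (l + 2) < k +
  -- 1`.
  have hek : e * (l + 2) ≤ k := by
    have h1 : e + 1 < s := by omega
    rw [hs, Nat.lt_ceil, lt_div_iff₀ hl0] at h1
    have h2 : (e + 1) * (l + 2) < k + l + 3 := by exact_mod_cast h1
    rw [add_mul] at h2
    omega
  rw [or_iff_not_imp_left, he]
  intro hpath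
  have hl : ∀ x y, T.dist x y + 1 < 2 ^ l := by
    intro x y
    by_contra hle
    exact hpath (containsPath_of_le_dist hT.connected (by positivity) (not_lt.1 hle))
  by_contra hsub
  obtain ⟨h1, h2⟩ := UM_le_of_no_large_branch (e := e) hT hl fun m w w' hw hw' => by
    by_contra hne
    exact hsub (hw.containsSubdivision hT hne hw')
  rw [mul_add, mul_comm e l] at hek
  -- For `e = 0` the bound is `2 < 3 ≤ k`, and for `e ≥ 2` it is `l * e + 2 < e * (l + 2) ≤ k`. For
  -- `e = 1` these would only be equal, so the improved bound `l + 1` is needed.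
  rcases Nat.lt_trichotomy e 1 with h | h | h
  · obtain rfl : e = 0 := by omega
    omega
  · have := h2 h
    subst h
    omega
  · omega
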